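/- **Setting.** Let $X$ be a complete metric space and $\Phi$ a local semiflow on $X$: each $x\in X$ has a maximal existence time $T_x\in(0,\infty]$, the set $\mathcal D=\{(t,x): 0\le t<T_x\}$ is open in $[0,\infty)\times X$, $\Phi:\mathcal D\to X$ is continuous, $\Phi(0)x=x$, and if $t+s<T_x$ then $t<T_{\Phi(s)x}$ and $\Phi(t+s)x=\Phi(t)\Phi(s)x$. A point $x$ is an *equilibrium* if $T_x=\infty$ and $\Phi(t)x=x$ for all $t\ge0$. $\Phi$ is *gradient* if there is a continuous $V:X\to\mathbb R$ such that $t\mapsto V(\Phi(t)x)$ is non-increasing on $[0,T_x)$ for each $x$, and every $x$ with $T_x=\infty$ and $V(\Phi(t)x)=V(x)$ for all $t\ge0$ is an equilibrium. **Pairs.** For $A\subset X$ put $t_A(x)=\inf\{t\ge0: t\ge T_x\text{ or }\Phi(t)x\notin A\}$. $A$ is *strongly admissible* if (a) whenever $x_n\in A$, $t_n\to\infty$ and $\Phi([0,t_n])x_n\subset A$ for all $n$, the sequence $\Phi(t_n)x_n$ has a convergent subsequence, and (b) $T_x=\infty$ whenever $\Phi(t)x\in A$ for all $t\in[0,T_x)$.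 A pair $(N,E)$ of closed subsets of $X$ is a *Ważewski pair* if (1) for $x\in N\cap E$ and $t\ge 0$, $\Phi([0,t])x\subset N$ implies $\Phi([0,t])x\subset E$; (2) for every $x\in N$ with $t_N(x)<T_x$ there is $t\le t_N(x)$ with $\Phi(t)x\in E$; (3) $H=\overline{N\setminus E}$ is strongly admissible. It is *transversal* if for every $x\in H\cap E$ and $t>0$ there is $s\in(0,t)$ with $s<T_x$ and $\Phi(s)x\notin H\cap E$. **Category.** Let $Y\subset A$ be closed subsets of a topological space $Z$. A closed set $C\subset Z$ is *contractible in $Z$* if there is a continuous $h:[0,1]\times C\to Z$ with $h(0,\cdot)=\mathrm{id}$ and $h(1,\cdot)$ constant. The relative category $\mathrm{cat}_{Z,Y}(A)$ is the least $n\in\{0,1,2,\dots\}\cup\{\infty\}$ such that $A=A_0\cup A_1\cup\dots\cup A_n$ with all $A_j$ closed in $Z$, $A_1,\dots,A_n$ contractible in $Z$, $Y\subset A_0$, and a continuous $h:[0,1]\times A_0\to Z$ with $h(0,x)=x$ and $h(1,x)\in Y$ for $x\in A_0$, and $h(s,Y)\subset Y$ for all $s$ (it is $\infty$ if no finite $n$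 works). For $E\neq\emptyset$, $E\subset N$, let $N/E$ be the quotient space of $N$ obtained by collapsing $E$ to one point $[E]$; for $E=\emptyset$ let $N/E$ be the topological sum $N\sqcup\{*\}$ and $[E]=*$. A metric space $Y$ is an *ANE* if for every metric space $M$, every closed $F\subset M$ and every continuous $f:F\to Y$, $f$ extends continuously to a neighborhood of $F$ in $M$. **Theorem.** Let $\Phi$ be a gradient local semiflow on the complete metric space $X$, and let $(N,E)$ be a transversal Ważewski pair for $\Phi$ with $E\subset N$. Suppose that $N$ is an ANE. Then the number of equilibria of $\Phi$ in $N\setminus E$ (in $\{0,1,2,\dots\}\cup\{\infty\}$) is at least $\mathrm{cat}_{N,E}(N)$, and it is also at least $\mathrm{cat}_{N/E,[E]}(N/E)$. -/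

import Mathlib

open scoped NNReal ENNReal

universe u

/-- A local semiflow on `X`. The domain is `{(t, x) | t < T x}`, an open subset of `[0, ∞) × X`, where
`T x ∈ (0, ∞]` is the maximal existence time of `x`. The values `flow t x` with `T x ≤ t` are
meaningless and are never used. -/
structure LocalSemiflow (X : Type u) [TopologicalSpace X] where
  /-- the maximal existence time -/
  T : X → ℝ≥0∞
  /-- the map `(t, x) ↦ Φ(t)x` -/
  flow : ℝ≥0 → X → X
  T_pos : ∀ x, 0 < T x
  isOpen_domain : IsOpen {p : ℝ≥0 × X | (p.1 : ℝ≥0∞) < T p.2}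
  continuousOn_flow :
    ContinuousOn (fun p : ℝ≥0 × X => flow p.1 p.2) {p : ℝ≥0 × X | (p.1 : ℝ≥0∞) < T p.2}
  flow_zero : ∀ x, flow 0 x = x
  flow_add : ∀ (t s : ℝ≥0) (x : X), ((t + s : ℝ≥0) : ℝ≥0∞) < T x →
    (t : ℝ≥0∞) < T (flow s x) ∧ flow (t + s) x = flow t (flow s x)

namespace LocalSemiflow

variable {X : Type u} [TopologicalSpace X]

/-- `Φ([0, t])x` is defined and contained in `N`. -/
def StaysIn (Φ : LocalSemiflow X) (N : Set X) (t : ℝ≥0) (x : X) : Prop :=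
  ∀ s : ℝ≥0, s ≤ t → (s : ℝ≥0∞) < Φ.T x ∧ Φ.flow s x ∈ N

/-- `Φ` does not explode in `N`. -/
def DoesNotExplodeIn (Φ : LocalSemiflow X) (N : Set X) : Prop :=
  ∀ x : X, (∀ t : ℝ≥0, (t : ℝ≥0∞) < Φ.T x → Φ.flow t x ∈ N) → Φ.T x = ⊤

/-- Admissibility: the end points of longer and longer orbit segments in `N` have a convergent
subsequence. -/
def Admissible (Φ : LocalSemiflow X) (N : Set X) : Prop :=
  ∀ (x : ℕ → X) (t : ℕ → ℝ≥0), (∀ n, x n ∈ N) → Filter.Tendsto t Filter.atTop Filter.atTop →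
    (∀ n, Φ.StaysIn N (t n) (x n)) →
    ∃ (y : X) (k : ℕ → ℕ), StrictMono k ∧
      Filter.Tendsto (fun n => Φ.flow (t (k n)) (x (k n))) Filter.atTop (nhds y)

/-- Strong admissibility. -/
def StronglyAdmissible (Φ : LocalSemiflow X) (N : Set X) : Prop :=
  Φ.Admissible N ∧ Φ.DoesNotExplodeIn N

/-- The set `A` is `N`-positively invariant. -/
def PositivelyInvariantIn (Φ : LocalSemiflow X) (N A : Set X) : Prop :=
  ∀ x ∈ N ∩ A, ∀ t : ℝ≥0, Φ.StaysIn N t x → Φ.StaysIn A t x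

/-- `t_N(x) = inf {t ≥ 0 | t ≥ T x or Φ(t)x ∉ N}`, with `inf ∅ = ∞`. -/
noncomputable def exitTime (Φ : LocalSemiflow X) (N : Set X) (x : X) : ℝ≥0∞ :=
  sInf ((fun t : ℝ≥0 => (t : ℝ≥0∞)) '' {t : ℝ≥0 | Φ.T x ≤ (t : ℝ≥0∞) ∨ Φ.flow t x ∉ N})

/-- `E` is an exit set of `N`. -/
def IsExitSet (Φ : LocalSemiflow X) (N E : Set X) : Prop :=
  Φ.PositivelyInvariantIn N E ∧
    ∀ x ∈ N, Φ.exitTime N x < Φ.T x →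
      ∃ t : ℝ≥0, (t : ℝ≥0∞) ≤ Φ.exitTime N x ∧ Φ.flow t x ∈ E

/-- `(N, E)` is a Ważewski pair. -/
def IsWazewskiPair (Φ : LocalSemiflow X) (N E : Set X) : Prop :=
  IsClosed N ∧ IsClosed E ∧ Φ.IsExitSet N E ∧ Φ.StronglyAdmissible (closure (N \ E))

/-- `(N, E)` is transversal: orbits starting in `closure (N \ E) ∩ E` are outside this set at
arbitrarily small positive times. -/
def IsTransversal (Φ : LocalSemiflow X) (N E : Set X) : Prop :=
  ∀ x ∈ closure (N \ E) ∩ E, ∀ t : ℝ≥0, 0 < t →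
    ∃ s : ℝ≥0, 0 < s ∧ s < t ∧ (s : ℝ≥0∞) < Φ.T x ∧ Φ.flow s x ∉ closure (N \ E) ∩ E

/-- `x` is an equilibrium: `Φ(t)x` is defined and equal to `x` for all `t ≥ 0`. -/
def IsEquilibrium (Φ : LocalSemiflow X) (x : X) : Prop :=
  ∀ t : ℝ≥0, (t : ℝ≥0∞) < Φ.T x ∧ Φ.flow t x = x

/-- `Φ` is gradient: it has a continuous Lyapunov function `V`, non-increasing along every orbit and
constant along a global forward orbit only if its initial point is an equilibrium. -/
def IsGradient (Φ : LocalSemiflow X) : Prop :=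
  ∃ V : X → ℝ, Continuous V ∧
    (∀ x, AntitoneOn (fun t : ℝ≥0 => V (Φ.flow t x)) {t : ℝ≥0 | (t : ℝ≥0∞) < Φ.T x}) ∧
    ∀ x, (∀ t : ℝ≥0, (t : ℝ≥0∞) < Φ.T x ∧ V (Φ.flow t x) = V x) → Φ.IsEquilibrium x

end LocalSemiflow

/-- `A` is contractible in `X`. -/
def ContractibleIn {X : Type u} [TopologicalSpace X] (A : Set X) : Prop :=
  ∃ h : C(unitInterval × A, X),
    (∀ x : A, h (0, x) = x) ∧ ∀ x y : A, h (1, x) = h (1, y)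

/-- The relation `A ≺_Y B` in `X`. -/
def DeformsInto {X : Type u} [TopologicalSpace X] (Y A B : Set X) : Prop :=
  Y ⊆ A ∩ B ∧ ∃ h : C(unitInterval × A, X),
    (∀ x : A, h (0, x) = x ∧ h (1, x) ∈ B) ∧
    ∀ (s : unitInterval) (x : A), (x : X) ∈ Y → h (s, x) ∈ Y

/-- `A` is the union of a closed set `A₀` with `A₀ ≺_Y Y` and of `n` closed sets that are contractible
in `X`. -/
def HasRelCover {X : Type u} [TopologicalSpace X] (Y A : Set X) (n : ℕ) : Prop :=
  ∃ (A₀ : Set X) (C : Fin n → Set X), IsClosed A₀ ∧ (∀ j, IsClosed (C j)) ∧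
    A = A₀ ∪ ⋃ j, C j ∧ (∀ j, ContractibleIn (C j)) ∧ DeformsInto Y A₀ Y

/-- The relative category `cat_{X,Y}(A)`: the least `n ≥ 0` for which a cover as above exists, and `∞`
if there is none. -/
noncomputable def relCat {X : Type u} [TopologicalSpace X] (Y A : Set X) : ℕ∞ :=
  ⨅ (n : ℕ) (_ : HasRelCover Y A n), (n : ℕ∞)

/-- Absolute neighborhood extensors for metric spaces. -/
def IsANE (Y : Type u) [TopologicalSpace Y] : Prop :=
  ∀ (Z : Type u) [MetricSpace Z] (F : Set Z), IsClosed F → ∀ f : C(F, Y),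
    ∃ (U : Set Z) (hFU : F ⊆ U) (g : C(U, Y)), IsOpen U ∧ ∀ x : F, g (Set.inclusion hFU x) = f x

/-- The equivalence relation on `Z ⊔ {*}` that identifies all points of `E ∪ {*}`. -/
def collapseSetoid {Z : Type u} (E : Set Z) : Setoid (Z ⊕ Unit) where
  r a b := a = b ∨ (a ∈ Sum.inl '' E ∪ {Sum.inr ()} ∧ b ∈ Sum.inl '' E ∪ {Sum.inr ()})
  iseqv :=
    { refl := fun _ => Or.inl rfl
      symm := fun h => h.elim (fun h => Or.inl h.symm) (fun h => Or.inr ⟨h.2, h.1⟩)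
      trans := fun {a b c} h k => by
        rcases h with rfl | h
        · exact k
        · rcases k with rfl | k
          · exact Or.inr h
          · exact Or.inr ⟨h.1, k.2⟩ }

/-- The quotient space `Z/E`, as the quotient of the topological sum `Z ⊔ {*}` by `E ∪ {*}`. If `E` is
nonempty, this is `Z` with `E` collapsed to one point (the extra point is glued to `E`); if `E` is
empty, it is the sum `Z ⊔ {*}`. -/
def CollapseSpace {Z : Type u} (E : Set Z) : Type u := Quotient (collapseSetoid E)

instance {Z : Type u} [TopologicalSpace Z] (E : Set Z) : TopologicalSpace (CollapseSpace E) :=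
  inferInstanceAs (TopologicalSpace (Quotient (collapseSetoid E)))

/-- The base point `[E]` of `Z/E`. -/
def collapsePoint {Z : Type u} (E : Set Z) : CollapseSpace E :=
  Quotient.mk (collapseSetoid E) (Sum.inr ())

/-! Infinitely many equilibria leave nothing to prove, so let there be finitely many in `N \ E`.
Transversality makes the first hitting time of `E` a continuous function on `N`
(`IsTransversal.continuous_hitTime`). Where it is finite, flowing up to it deforms points into `E`
and fixes `E` (`IsWazewskiPair.deformsInto`).

The other points stay in `N \ E` forever. Admissibility and the Lyapunov function `V` make each of
them converge to an equilibrium (`IsLyapunov.exists_tendsto`). Stable sets of equilibria need not be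
closed: orbits attracted by `a` can accumulate on orbits attracted by some `e`, but only if `V e > V
a`. This follows from `IsLyapunov.stable`. Hence, treating equilibria by decreasing `V` and removing
open sets already chosen, one meets only closed pieces (`IsLyapunov.isClosed_attracted`). Each piece
has a closed neighborhood that flows into a small neighborhood of its equilibrium, which contracts
in `N` because `N` is an ANE (`IsLyapunov.exists_contractible_nhds`). These neighborhoods, one per
equilibrium, and the complement of their interiors' chosen open subsets give the cover for the first
estimate.

The contractible sets avoid `E`, so they embed in `N/E`, and the deformation into `E` descends to
the quotient; the same cover therefore gives the second estimate. -/

open Filter Topology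

namespace LocalSemiflow

variable {X : Type u}

/-! ### The hitting time of `E` and its continuity on `N`. -/

section Topological

variable [TopologicalSpace X] (Φ : LocalSemiflow X) {N E : Set X} {x : X} {t : ℝ≥0}

theorem flow_comp_continuous {Z : Type*} [TopologicalSpace Z] {f : Z → ℝ≥0} {g : Z → X}
    (hf : Continuous f) (hg : Continuous g) (h : ∀ z, (f z : ℝ≥0∞) < Φ.T (g z)) :
    Continuous fun z => Φ.flow (f z) (g z) :=
  Φ.continuousOn_flow.comp_continuous (hf.prodMk hg) h

theorem continuousAt_flow (h : (t : ℝ≥0∞) < Φ.T x) :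
    ContinuousAt (fun p : ℝ≥0 × X => Φ.flow p.1 p.2) (t, x) :=
  Φ.continuousOn_flow.continuousAt (Φ.isOpen_domain.mem_nhds h)

theorem isOpen_flow_mem {U : Set X} (hU : IsOpen U) :
    IsOpen {p : ℝ≥0 × X | (p.1 : ℝ≥0∞) < Φ.T p.2 ∧ Φ.flow p.1 p.2 ∈ U} :=
  Φ.continuousOn_flow.isOpen_inter_preimage Φ.isOpen_domain hU

/-- Orbit segments that lie in an open set persist under perturbation of the initial point. -/
theorem eventually_segment_mem {U : Set X} (hU : IsOpen U)
    (h : ∀ s ≤ t, (s : ℝ≥0∞) < Φ.T x ∧ Φ.flow s x ∈ U) :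
    ∀ᶠ y in 𝓝 x, ∀ s ≤ t, (s : ℝ≥0∞) < Φ.T y ∧ Φ.flow s y ∈ U := by
  obtain ⟨u, v, -, hv, hu, hxv, huv⟩ :=
    generalized_tube_lemma (s := Set.Icc 0 t) (t := {x}) isCompact_Icc isCompact_singleton
      (Φ.isOpen_flow_mem hU) (by
        rintro ⟨s, y⟩ ⟨hs, rfl⟩
        exact h s hs.2)
  filter_upwards [hv.mem_nhds (hxv rfl)] with y hy s hs
  exact huv (Set.mk_mem_prod (hu ⟨zero_le, hs⟩) hy)

/-- The first time at which an orbit is in `E`. -/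
noncomputable def hitTime (E : Set X) (x : X) : ℝ≥0∞ :=
  ⨅ (t : ℝ≥0) (_ : (t : ℝ≥0∞) < Φ.T x ∧ Φ.flow t x ∈ E), (t : ℝ≥0∞)

variable {Φ}

theorem hitTime_lt_iff {r : ℝ≥0∞} :
    Φ.hitTime E x < r ↔ ∃ t : ℝ≥0, ((t : ℝ≥0∞) < Φ.T x ∧ Φ.flow t x ∈ E) ∧ (t : ℝ≥0∞) < r := by
  simp only [hitTime, iInf_lt_iff, exists_prop]

theorem hitTime_le (h : (t : ℝ≥0∞) < Φ.T x) (hE : Φ.flow t x ∈ E) :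
    Φ.hitTime E x ≤ t :=
  iInf₂_le t ⟨h, hE⟩

theorem hitTime_eq_zero (h : x ∈ E) : Φ.hitTime E x = 0 := by
  simpa using hitTime_le (Φ := Φ) (E := E) (t := 0) (x := x) (by simpa using Φ.T_pos x)
    (by rwa [Φ.flow_zero])

theorem flow_mem_of_T_le_exitTime (h : Φ.T x ≤ Φ.exitTime N x) (ht : (t : ℝ≥0∞) < Φ.T x) :
    Φ.flow t x ∈ N := by
  by_contra hN
  exact absurd (h.trans (sInf_le ⟨t, Or.inr hN, rfl⟩)) (not_le.2 ht)

/-- Leaving `N` before the existence time forces a visit to `E` no later than the exit, by the exit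
set property. Otherwise the orbit stays in `N \ E` for its whole lifetime, and then it cannot
explode. -/
theorem IsWazewskiPair.mem_of_lt_hitTime (hW : Φ.IsWazewskiPair N E) (hx : x ∈ N)
    (ht : (t : ℝ≥0∞) < Φ.hitTime E x) : (t : ℝ≥0∞) < Φ.T x ∧ Φ.flow t x ∈ N \ E := by
  have hE : ∀ s : ℝ≥0, (s : ℝ≥0∞) < Φ.T x → (s : ℝ≥0∞) < Φ.hitTime E x → Φ.flow s x ∉ E :=
    fun s hs hs' h => (hitTime_le hs h).not_gt hs'
  by_contra hcon
  have hbad : Φ.T x ≤ t ∨ Φ.flow t x ∉ N := by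
    by_contra! h
    exact hcon ⟨h.1, h.2, hE t h.1 ht⟩
  have hexit : Φ.exitTime N x ≤ t := sInf_le ⟨t, hbad, rfl⟩
  rcases lt_or_ge (Φ.exitTime N x) (Φ.T x) with h | h
  · obtain ⟨s, hs, hsE⟩ := hW.2.2.1.2 x hx h
    exact hE s (hs.trans_lt h) ((hs.trans hexit).trans_lt ht) hsE
  · have hT := hW.2.2.2.2 x fun s hs => subset_closure
      ⟨flow_mem_of_T_le_exitTime h hs, hE s hs (hs.trans_le (h.trans hexit) |>.trans ht)⟩
    exact absurd (h.trans hexit) (by simp [hT])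

theorem hitTime_attained (hE : IsClosed E) (h : Φ.hitTime E x ≠ ⊤) :
    Φ.hitTime E x < Φ.T x ∧ Φ.flow (Φ.hitTime E x).toNNReal x ∈ E := by
  obtain ⟨t₀, ⟨ht₀, ht₀E⟩, -⟩ := hitTime_lt_iff.1 h.lt_top
  have hlt : Φ.hitTime E x < Φ.T x := (hitTime_le ht₀ ht₀E).trans_lt ht₀
  refine ⟨hlt, ?_⟩
  set r := (Φ.hitTime E x).toNNReal with hr
  have hrr : (r : ℝ≥0∞) = Φ.hitTime E x := ENNReal.coe_toNNReal h
  by_contra hcon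
  have hc : ContinuousAt (fun s : ℝ≥0 => Φ.flow s x) r :=
    (Φ.continuousAt_flow (t := r) (x := x) (hrr ▸ hlt)).comp
      (f := fun s : ℝ≥0 => (s, x)) (by fun_prop)
  have hev := hc (hE.isOpen_compl.mem_nhds hcon)
  -- If the infimum `r` were not attained, the orbit would avoid the closed set `E` on some `[r,
  -- b)`, yet there are hits before `b`.
  obtain ⟨b, hb, hsub⟩ := exists_Ico_subset_of_mem_nhds hev ⟨r + 1, by simp⟩
  obtain ⟨s, ⟨hs, hsE⟩, hsb⟩ := hitTime_lt_iff.1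
    (show Φ.hitTime E x < b by rw [← hrr]; exact_mod_cast hb)
  refine hsub ⟨?_, by exact_mod_cast hsb⟩ hsE
  have := hitTime_le hs hsE
  rw [← hrr] at this
  exact_mod_cast this

/-- Lower semicontinuity: a compact orbit segment that misses the closed set `E` still misses it
after a perturbation. -/
theorem eventually_lt_hitTime (hE : IsClosed E) {r : ℝ≥0∞}
    (hr : r < Φ.hitTime E x) (hx : ∀ t : ℝ≥0, (t : ℝ≥0∞) < Φ.hitTime E x → (t : ℝ≥0∞) < Φ.T x) :
    ∀ᶠ y in 𝓝 x, r < Φ.hitTime E y := by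
  obtain ⟨t, hrt, ht⟩ := ENNReal.lt_iff_exists_nnreal_btwn.1 hr
  filter_upwards [Φ.eventually_segment_mem hE.isOpen_compl (x := x) (t := t) fun s hs =>
    have hs' : (s : ℝ≥0∞) < Φ.hitTime E x := (ENNReal.coe_le_coe.2 hs).trans_lt ht
    ⟨hx s hs', fun h => (hitTime_le (hx s hs') h).not_gt hs'⟩] with y hy
  refine hrt.trans_le (le_of_not_gt fun hlt => ?_)
  obtain ⟨s, hs, hst⟩ := hitTime_lt_iff.1 hlt
  exact (hy s (by exact_mod_cast hst.le)).2 hs.2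

theorem IsWazewskiPair.closure_subset (hW : Φ.IsWazewskiPair N E) : closure (N \ E) ⊆ N :=
  closure_minimal Set.sdiff_subset hW.1

/-- An orbit that starts in `closure (N \ E)` is still in this set when it first meets `E`. -/
theorem IsWazewskiPair.flow_hitTime_mem_closure (hW : Φ.IsWazewskiPair N E)
    (hx : x ∈ closure (N \ E)) (h : Φ.hitTime E x ≠ ⊤) :
    Φ.flow (Φ.hitTime E x).toNNReal x ∈ closure (N \ E) := by
  have hxN : x ∈ N := hW.closure_subset hx
  obtain ⟨hlt, hE⟩ := hitTime_attained hW.2.1 h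
  set r := (Φ.hitTime E x).toNNReal with hr
  have hrr : (r : ℝ≥0∞) = Φ.hitTime E x := ENNReal.coe_toNNReal h
  rcases eq_or_ne r 0 with h0 | h0
  · rwa [h0, Φ.flow_zero]
  have hc : ContinuousAt (fun s : ℝ≥0 => Φ.flow s x) r :=
    (Φ.continuousAt_flow (t := r) (x := x) (hrr ▸ hlt)).comp
      (f := fun s : ℝ≥0 => (s, x)) (by fun_prop)
  have : (𝓝[<] r).NeBot := nhdsLT_neBot_of_exists_lt ⟨0, pos_iff_ne_zero.2 h0⟩
  refine mem_closure_of_tendsto (hc.tendsto.mono_left nhdsWithin_le_nhds) (b := 𝓝[<] r) ?_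
  filter_upwards [self_mem_nhdsWithin] with s hs
  exact (hW.mem_of_lt_hitTime hxN (by rw [← hrr]; exact_mod_cast hs)).2

/-- An orbit from `E` that stays in `closure (N \ E)` stays in `E` by positive invariance. So
leaving the intersection, as transversality demands, means leaving `closure (N \ E)` itself. -/
theorem IsTransversal.exists_flow_notMem (hW : Φ.IsWazewskiPair N E) (hT : Φ.IsTransversal N E)
    (hx : x ∈ closure (N \ E) ∩ E) (ht : 0 < t) :
    ∃ s : ℝ≥0, s < t ∧ (s : ℝ≥0∞) < Φ.T x ∧ Φ.flow s x ∉ closure (N \ E) := by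
  obtain ⟨s, -, hst, hsT, hs⟩ := hT x hx t ht
  by_contra! hcon
  have hstay : Φ.StaysIn N s x := fun r hr =>
    have hrT := (ENNReal.coe_le_coe.2 hr).trans_lt hsT
    ⟨hrT, hW.closure_subset (hcon r (hr.trans_lt hst) hrT)⟩
  exact hs ⟨hcon s hst hsT,
    (hW.2.2.1.1 x ⟨hW.closure_subset hx.1, hx.2⟩ s hstay s le_rfl).2⟩

/-- Upper semicontinuity: just after its first hit the orbit is outside `closure (N \ E)`, which is
an open condition. A nearby orbit that starts in `N` is outside it at the same time, so it must have
met `E` by then. -/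
theorem IsTransversal.eventually_hitTime_lt (hW : Φ.IsWazewskiPair N E)
    (hT : Φ.IsTransversal N E) {r : ℝ≥0∞} (hr : Φ.hitTime E x < r) :
    ∀ᶠ y in 𝓝 x, y ∈ N → Φ.hitTime E y < r := by
  by_cases hxH : x ∈ closure (N \ E)
  · have htop : Φ.hitTime E x ≠ ⊤ := hr.ne_top
    obtain ⟨hlt, hE⟩ := hitTime_attained hW.2.1 htop
    have hH := hW.flow_hitTime_mem_closure hxH htop
    set a := (Φ.hitTime E x).toNNReal with ha
    have haa : (a : ℝ≥0∞) = Φ.hitTime E x := ENNReal.coe_toNNReal htop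
    obtain ⟨b, hab, hb⟩ := ENNReal.lt_iff_exists_nnreal_btwn.1 (lt_min hr hlt)
    rw [← haa, ENNReal.coe_lt_coe] at hab
    obtain ⟨s, hs, -, hsH⟩ := hT.exists_flow_notMem hW ⟨hH, hE⟩ (tsub_pos_of_lt hab)
    have hsb : s + a < b := lt_tsub_iff_right.1 hs
    have hsb' : ((s + a : ℝ≥0) : ℝ≥0∞) < min r (Φ.T x) :=
      (ENNReal.coe_lt_coe.2 hsb).trans hb
    rw [← (Φ.flow_add s a x (hsb'.trans_le (min_le_right _ _))).2] at hsH
    have hopen := (Φ.isOpen_flow_mem (isClosed_closure (s := N \ E)).isOpen_compl).mem_nhds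
      (show (s + a, x) ∈ _ from ⟨hsb'.trans_le (min_le_right _ _), hsH⟩)
    filter_upwards [(by fun_prop : Continuous fun y : X => (s + a, y)).continuousAt.preimage_mem_nhds
      hopen] with y hy hyN
    refine lt_of_le_of_lt (le_of_not_gt fun hlt' => ?_) (hsb'.trans_le (min_le_left _ _))
    exact hy.2 (subset_closure (hW.mem_of_lt_hitTime hyN hlt').2)
  · filter_upwards [isClosed_closure.isOpen_compl.mem_nhds hxH] with y hy hyN
    have hyE : y ∈ E := by
      by_contra h
      exact hy (subset_closure ⟨hyN, h⟩)
    rw [hitTime_eq_zero hyE]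
    exact zero_le.trans_lt hr

theorem IsTransversal.continuous_hitTime (hW : Φ.IsWazewskiPair N E)
    (hT : Φ.IsTransversal N E) : Continuous fun x : N => Φ.hitTime E (x : X) := by
  refine continuous_iff_continuousAt.2 fun x => tendsto_order.2 ⟨fun r hr => ?_, fun r hr => ?_⟩
  · exact continuous_subtype_val.continuousAt.eventually
      (eventually_lt_hitTime hW.2.1 hr fun t ht => (hW.mem_of_lt_hitTime x.2 ht).1)
  · filter_upwards [continuous_subtype_val.continuousAt.eventually
      (hT.eventually_hitTime_lt hW hr)] with y hy
    exact hy y.2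

theorem IsWazewskiPair.mem_of_le_hitTime (hW : Φ.IsWazewskiPair N E) (hEN : E ⊆ N) (hx : x ∈ N)
    (ht : (t : ℝ≥0∞) ≤ Φ.hitTime E x) : (t : ℝ≥0∞) < Φ.T x ∧ Φ.flow t x ∈ N := by
  rcases ht.lt_or_eq with h | h
  · exact (hW.mem_of_lt_hitTime hx h).imp_right And.left
  · obtain ⟨h1, h2⟩ := hitTime_attained hW.2.1 (h ▸ ENNReal.coe_ne_top)
    rw [← h, ENNReal.toNNReal_coe] at h2
    exact ⟨h ▸ h1, hEN h2⟩

theorem IsWazewskiPair.T_eq_top (hW : Φ.IsWazewskiPair N E) (hx : x ∈ N)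
    (h : Φ.hitTime E x = ⊤) : Φ.T x = ⊤ := by
  refine ENNReal.eq_top_of_forall_nnreal_le fun r => ?_
  exact (hW.mem_of_lt_hitTime hx (t := r) (by simp [h])).1.le

theorem IsTransversal.notMem_of_isEquilibrium (hT : Φ.IsTransversal N E)
    (hx : x ∈ closure (N \ E)) (he : Φ.IsEquilibrium x) : x ∉ E := fun hE => by
  obtain ⟨s, -, -, -, h⟩ := hT x ⟨hx, hE⟩ 1 one_pos
  exact h ((he s).2.symm ▸ ⟨hx, hE⟩)

theorem hitTime_flow_eq_top (hT : Φ.T x = ⊤) (h : Φ.hitTime E x = ⊤) (s : ℝ≥0) :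
    Φ.hitTime E (Φ.flow s x) = ⊤ := by
  by_contra hcon
  obtain ⟨t, ⟨-, htE⟩, -⟩ := hitTime_lt_iff.1 (lt_top_iff_ne_top.2 hcon)
  have hts : ((t + s : ℝ≥0) : ℝ≥0∞) < Φ.T x := by simp [hT]
  rw [← (Φ.flow_add t s x hts).2] at htE
  exact absurd (hitTime_le hts htE) (by rw [h]; simp [-ENNReal.coe_add])

end Topological

end LocalSemiflow

/-! ### Gradient dynamics: stability of equilibria and convergence of orbits. -/

namespace LocalSemiflow

variable {X : Type u} [MetricSpace X] {Φ : LocalSemiflow X} {N E : Set X}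

/-- `V` is a Lyapunov function that exhibits `Φ` as gradient. -/
structure IsLyapunov (Φ : LocalSemiflow X) (V : X → ℝ) : Prop where
  continuous : Continuous V
  antitoneOn : ∀ x, AntitoneOn (fun t : ℝ≥0 => V (Φ.flow t x)) {t : ℝ≥0 | (t : ℝ≥0∞) < Φ.T x}
  isEquilibrium : ∀ x, (∀ t : ℝ≥0, (t : ℝ≥0∞) < Φ.T x ∧ V (Φ.flow t x) = V x) → Φ.IsEquilibrium x

/-- If `V` tends to one and the same value along later and later shifts of orbits that remain in
`N \ E`, then the end points of these orbit segments subconverge to an equilibrium. -/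
theorem IsLyapunov.exists_tendsto_isEquilibrium {V : X → ℝ} (hV : Φ.IsLyapunov V)
    (hW : Φ.IsWazewskiPair N E) (hT : Φ.IsTransversal N E) {y : ℕ → X} {t : ℕ → ℝ≥0} {c : ℝ}
    (hy : ∀ n, y n ∈ N ∧ Φ.hitTime E (y n) = ⊤) (ht : Tendsto t atTop atTop)
    (hc : ∀ s : ℝ≥0, Tendsto (fun n => V (Φ.flow (s + t n) (y n))) atTop (𝓝 c)) :
    ∃ (z : X) (k : ℕ → ℕ), StrictMono k ∧
      Tendsto (fun n => Φ.flow (t (k n)) (y (k n))) atTop (𝓝 z) ∧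
      z ∈ N \ E ∧ Φ.IsEquilibrium z ∧ V z = c := by
  have hmem : ∀ n (s : ℝ≥0), (s : ℝ≥0∞) < Φ.T (y n) ∧ Φ.flow s (y n) ∈ closure (N \ E) :=
    fun n s => (hW.mem_of_lt_hitTime (hy n).1 (by simp [(hy n).2])).imp_right
      fun h => subset_closure h
  obtain ⟨z, k, hk, hz⟩ := hW.2.2.2.1 y t
    (fun n => by simpa [Φ.flow_zero] using (hmem n 0).2) ht fun n s _ => hmem n s
  have hlim : ∀ s : ℝ≥0, (s : ℝ≥0∞) < Φ.T z →
      Tendsto (fun n => Φ.flow (s + t (k n)) (y (k n))) atTop (𝓝 (Φ.flow s z)) := fun s hs => by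
    refine ((Φ.continuousAt_flow hs).tendsto.comp (tendsto_const_nhds.prodMk_nhds hz)).congr
      fun n => ?_
    exact (Φ.flow_add _ _ _ (hmem (k n) _).1).2.symm
  have hTz : Φ.T z = ⊤ := hW.2.2.2.2 z fun s hs =>
    isClosed_closure.mem_of_tendsto (hlim s hs) (Eventually.of_forall fun n => (hmem (k n) _).2)
  -- `V` is constant along the orbit of the limit point, which is what forces an equilibrium.
  have hVz : ∀ s : ℝ≥0, V (Φ.flow s z) = c := fun s =>
    tendsto_nhds_unique ((hV.continuous.tendsto _).comp (hlim s (by simp [hTz])))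
      ((hc s).comp hk.tendsto_atTop)
  have hVz0 : V z = c := by simpa [Φ.flow_zero] using hVz 0
  have heq : Φ.IsEquilibrium z :=
    hV.isEquilibrium z fun s => ⟨by simp [hTz], (hVz s).trans hVz0.symm⟩
  have hzH : z ∈ closure (N \ E) :=
    isClosed_closure.mem_of_tendsto hz (Eventually.of_forall fun n => (hmem (k n) _).2)
  exact ⟨z, k, hk, hz, ⟨hW.closure_subset hzH, hT.notMem_of_isEquilibrium hzH heq⟩, heq, hVz0⟩

/-- An isolated equilibrium is stable with respect to orbits in `N \ E` along which `V` does not drop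
below its value at the equilibrium. -/
theorem IsLyapunov.stable {V : X → ℝ} (hV : Φ.IsLyapunov V)
    (hW : Φ.IsWazewskiPair N E) (hT : Φ.IsTransversal N E)
    (hfin : {x : X | x ∈ N \ E ∧ Φ.IsEquilibrium x}.Finite) {e : X} (he : Φ.IsEquilibrium e)
    {U : Set X} (hU : U ∈ 𝓝 e) :
    ∀ᶠ y in 𝓝 e, y ∈ N → Φ.hitTime E y = ⊤ → (∀ t : ℝ≥0, V e ≤ V (Φ.flow t y)) →
      ∀ t : ℝ≥0, Φ.flow t y ∈ U := by
  have hQ : (U ∩ ({x : X | x ∈ N \ E ∧ Φ.IsEquilibrium x} \ {e})ᶜ) ∈ 𝓝 e :=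
    inter_mem hU ((hfin.subset Set.sdiff_subset).isClosed.isOpen_compl.mem_nhds (by simp))
  -- This ball lies in `U` and contains no other equilibrium of `N \ E`. Orbits that start ever
  -- closer to `e` and leave `U` cross its boundary sphere; a limit of the crossing points will be a
  -- forbidden equilibrium.
  obtain ⟨ε, hε, hball⟩ := Metric.nhds_basis_closedBall.mem_iff.1 hQ
  by_contra hcon
  have hfreq := not_eventually.1 hcon
  obtain ⟨y, hy, hyP⟩ := exists_seq_forall_of_frequently hfreq
  simp only [not_forall] at hyP
  choose hyN hytop hyV r hr using hyP
  have hmem : ∀ n (s : ℝ≥0), (s : ℝ≥0∞) < Φ.T (y n) := fun n s => by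
    simp [hW.T_eq_top (hyN n) (hytop n)]
  obtain ⟨t, ht⟩ : ∃ t : ℕ → ℝ≥0, ∀ᶠ n in atTop, dist (Φ.flow (t n) (y n)) e = ε := by
    have : ∀ᶠ n in atTop, ∃ t : ℝ≥0, dist (Φ.flow t (y n)) e = ε := by
      filter_upwards [hy (Metric.ball_mem_nhds e hε)] with n hn
      have hcont : Continuous fun s : ℝ≥0 => dist (Φ.flow s (y n)) e :=
        (Φ.flow_comp_continuous continuous_id continuous_const (hmem n)).dist continuous_const
      refine mem_range_of_exists_le_of_exists_ge hcont ⟨0, ?_⟩ ⟨r n, ?_⟩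
      · simpa [Φ.flow_zero] using (Metric.mem_ball.1 hn).le
      · exact le_of_not_ge fun h => hr n (hball (Metric.mem_closedBall.2 h)).1
    exact this.choice
  -- Since `e` is at rest, orbits starting near it stay in the open ball for any prescribed time.
  have httop : Tendsto t atTop atTop := by
    refine tendsto_atTop.2 fun R => ?_
    have := Φ.eventually_segment_mem (x := e) (t := R) (Metric.isOpen_ball (x := e) (ε := ε))
      fun s _ => ⟨(he s).1, by simpa [(he s).2] using hε⟩
    filter_upwards [hy this, ht] with n hn htn
    refine le_of_not_gt fun h => ?_
    exact ((hn _ h.le).2.ne htn).elim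
  -- `V` is squeezed between `V e` and its value at the initial points, which tends to `V e`.
  have hc : ∀ s : ℝ≥0, Tendsto (fun n => V (Φ.flow (s + t n) (y n))) atTop (𝓝 (V e)) := fun s => by
    refine tendsto_of_tendsto_of_tendsto_of_le_of_le tendsto_const_nhds
      ((hV.continuous.tendsto e).comp hy) (fun n => hyV n _) fun n => ?_
    simpa [Φ.flow_zero] using
      hV.antitoneOn (y n) (hmem n 0) (hmem n (s + t n)) (zero_le (a := s + t n))
  obtain ⟨z, k, hk, hz, hzN, hzeq, -⟩ :=
    hV.exists_tendsto_isEquilibrium hW hT (fun n => ⟨hyN n, hytop n⟩) httop hc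
  have hdist : dist z e = ε := tendsto_nhds_unique (hz.dist tendsto_const_nhds)
    (tendsto_const_nhds.congr' ((hk.tendsto_atTop.eventually ht).mono fun n hn => hn.symm))
  have := (hball (Metric.mem_closedBall.2 hdist.le)).2
  simp only [Set.mem_compl_iff, Set.mem_sdiff, Set.mem_ofPred_eq, Set.mem_singleton_iff, not_and,
    not_not] at this
  rw [this ⟨hzN, hzeq⟩, dist_self] at hdist
  exact hε.ne hdist

theorem IsLyapunov.le_of_tendsto {V : X → ℝ} (hV : Φ.IsLyapunov V) {x e : X} (hx : Φ.T x = ⊤)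
    (h : Tendsto (fun t : ℝ≥0 => Φ.flow t x) atTop (𝓝 e)) (t : ℝ≥0) : V e ≤ V (Φ.flow t x) := by
  refine _root_.le_of_tendsto ((hV.continuous.tendsto e).comp h) ?_
  filter_upwards [eventually_ge_atTop t] with s hs
  exact hV.antitoneOn x (by simp [hx]) (by simp [hx]) hs

/-- Orbits that remain in `N \ E` converge to equilibria. -/
theorem IsLyapunov.exists_tendsto {V : X → ℝ} (hV : Φ.IsLyapunov V)
    (hW : Φ.IsWazewskiPair N E) (hT : Φ.IsTransversal N E)
    (hfin : {x : X | x ∈ N \ E ∧ Φ.IsEquilibrium x}.Finite) {x : X} (hx : x ∈ N)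
    (htop : Φ.hitTime E x = ⊤) :
    ∃ e, (e ∈ N \ E ∧ Φ.IsEquilibrium e) ∧
      Tendsto (fun t : ℝ≥0 => Φ.flow t x) atTop (𝓝 e) := by
  have hTx := hW.T_eq_top hx htop
  have hlt : ∀ s : ℝ≥0, (s : ℝ≥0∞) < Φ.T x := fun s => by simp [hTx]
  have hanti : Antitone fun t : ℝ≥0 => V (Φ.flow t x) := fun s t hst =>
    hV.antitoneOn x (hlt s) (hlt t) hst
  have hn : Tendsto (fun n : ℕ => (n : ℝ≥0)) atTop atTop := tendsto_natCast_atTop_atTop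
  have hmem : ∀ s : ℝ≥0, Φ.flow s x ∈ N \ E := fun s =>
    (hW.mem_of_lt_hitTime hx (by simp [htop])).2
  obtain ⟨c, hc⟩ : ∃ c, Tendsto (fun t : ℝ≥0 => V (Φ.flow t x)) atTop (𝓝 c) := by
    -- `V` cannot fall to `-∞`, because admissibility gives the orbit a limit point.
    refine (tendsto_atTop_of_antitone hanti).resolve_left fun hbot => ?_
    obtain ⟨z, k, hk, hz⟩ := hW.2.2.2.1 (fun _ => x) (fun n => (n : ℝ≥0))
      (fun n => subset_closure (by simpa [Φ.flow_zero] using hmem 0)) hn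
      fun n s _ => ⟨hlt s, subset_closure (hmem s)⟩
    exact not_tendsto_nhds_of_tendsto_atBot (hbot.comp (hn.comp hk.tendsto_atTop)) _
      ((hV.continuous.tendsto z).comp hz)
  obtain ⟨z, k, hk, hz, hzN, hzeq, hzc⟩ :=
    hV.exists_tendsto_isEquilibrium hW hT (y := fun _ => x) (t := fun n => (n : ℝ≥0))
      (fun _ => ⟨hx, htop⟩) hn fun s => hc.comp (tendsto_atTop_mono (fun n => le_add_self) hn)
  refine ⟨z, ⟨hzN, hzeq⟩, fun U hU => ?_⟩
  -- One visit close enough to the limit point `z` suffices: `V` never drops below `V z` on the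
  -- orbit, so stability traps it in `U`.
  obtain ⟨n, hn⟩ := (hz.eventually (hV.stable hW hT hfin hzeq hU)).exists
  rw [mem_map]
  have hge : ∀ t : ℝ≥0, V z ≤ V (Φ.flow t x) := fun t => hzc ▸ hanti.le_of_tendsto hc t
  filter_upwards [eventually_ge_atTop ((k n : ℕ) : ℝ≥0)] with t ht
  obtain ⟨s, rfl⟩ : ∃ s, t = s + _ := ⟨_, (tsub_add_cancel_of_le ht).symm⟩
  rw [Set.mem_preimage, (Φ.flow_add _ _ _ (hlt _)).2]
  refine hn (hmem _).1 (hitTime_flow_eq_top hTx htop _) (fun r => ?_) s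
  rw [← (Φ.flow_add _ _ _ (hlt _)).2]
  exact hge _

/-- Points near the stable set of `e` that remain in `N \ E`, and whose limit is not below `e`, are
near `e` at all times after a common one. -/
theorem IsLyapunov.exists_time {V : X → ℝ} (hV : Φ.IsLyapunov V)
    (hW : Φ.IsWazewskiPair N E) (hT : Φ.IsTransversal N E)
    (hfin : {x : X | x ∈ N \ E ∧ Φ.IsEquilibrium x}.Finite) {x e : X}
    (hx : x ∈ N) (htop : Φ.hitTime E x = ⊤) (he : Φ.IsEquilibrium e)
    (hlim : Tendsto (fun t : ℝ≥0 => Φ.flow t x) atTop (𝓝 e)) {U : Set X} (hU : U ∈ 𝓝 e) :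
    ∃ r : ℝ≥0, ∀ᶠ y in 𝓝 x, y ∈ N → Φ.hitTime E y = ⊤ →
      (∀ t : ℝ≥0, V e ≤ V (Φ.flow t y)) → ∀ t ≥ r, Φ.flow t y ∈ U := by
  obtain ⟨r, hr⟩ := (hlim.eventually (hV.stable hW hT hfin he hU).eventually_nhds).exists
  refine ⟨r, ?_⟩
  have hcont : ContinuousAt (fun y : X => Φ.flow r y) x :=
    (Φ.continuousAt_flow (t := r) (x := x) (by simp [hW.T_eq_top hx htop])).comp
      (f := fun y : X => (r, y)) (by fun_prop)
  filter_upwards [hcont.eventually hr] with y hy hyN hyt hyV t ht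
  have hTy := hW.T_eq_top hyN hyt
  obtain ⟨s, rfl⟩ : ∃ s, t = s + _ := ⟨_, (tsub_add_cancel_of_le ht).symm⟩
  rw [(Φ.flow_add _ _ _ (by simp [hTy])).2]
  refine hy (hW.mem_of_lt_hitTime hyN (by simp [hyt])).2.1 (hitTime_flow_eq_top hTy hyt _)
    (fun q => ?_) s
  rw [← (Φ.flow_add _ _ _ (by simp [hTy])).2]
  exact hyV _

end LocalSemiflow

/-! ### Deformations into `E` and contractions in `N`. -/

/-- In an absolute neighborhood extensor, every point has a neighborhood that is contractible
to this point. -/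
theorem IsANE.exists_contraction {Y : Type u} [MetricSpace Y] (hY : IsANE Y) (e : Y) :
    ∃ U : Set Y, IsOpen U ∧ e ∈ U ∧ ∃ k : C(unitInterval × U, Y),
      (∀ x : U, k (0, x) = x) ∧ ∀ x : U, k (1, x) = e := by
  let F : Set (Y × unitInterval) := {p | p.2 = 0 ∨ p.1 = e ∨ p.2 = 1}
  have hF : IsClosed F :=
    (isClosed_eq continuous_snd continuous_const).union
      ((isClosed_eq continuous_fst continuous_const).union
        (isClosed_eq continuous_snd continuous_const))
  let f : C(F, Y) :=
    -- The identity on the bottom and the constant `e` on the top and on the segment over `e`. At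
    -- the switching height `1 / 2`, the domain contains only points over `e`, where both branches
    -- agree.
    ⟨fun p => if (p.1.2 : ℝ) ≤ 1 / 2 then p.1.1 else e, by
      refine Continuous.if_le (by fun_prop) continuous_const (by fun_prop) continuous_const ?_
      rintro ⟨⟨y, s⟩, h | h | h⟩ hs
      · simp only at h hs
        norm_num [h] at hs
      · exact h
      · simp only at h hs
        norm_num [h] at hs⟩
  obtain ⟨W, hFW, g, hW, hg⟩ := hY _ F hF f
  obtain ⟨u, v, hu, -, heu, hv, huv⟩ :=
    generalized_tube_lemma (s := {e}) (t := (Set.univ : Set unitInterval)) isCompact_singleton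
      isCompact_univ hW fun p hp => hFW (Or.inr (Or.inl hp.1))
  have hmem : ∀ (s : unitInterval) (x : u), ((x : Y), s) ∈ W := fun s x =>
    huv ⟨x.2, hv trivial⟩
  refine ⟨u, hu, heu rfl, ⟨fun p => g ⟨(p.2, p.1), hmem p.1 p.2⟩, by fun_prop⟩, fun x => ?_,
    fun x => ?_⟩
  · have := hg ⟨((x : Y), 0), Or.inl rfl⟩
    simpa [f, Set.inclusion] using this
  · have := hg ⟨((x : Y), 1), Or.inr (Or.inr rfl)⟩
    have h2 : ¬ ((1 : ℝ) ≤ 1 / 2) := by norm_num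
    simpa only [f, Set.inclusion, ContinuousMap.coe_mk, Set.Icc.coe_one, if_neg h2] using this

theorem contractibleIn_of_homotopic {Z : Type*} [TopologicalSpace Z] {A : Set Z} {e : Z}
    (h : ContinuousMap.Homotopic (⟨Subtype.val, continuous_subtype_val⟩ : C(A, Z))
      (ContinuousMap.const A e)) : ContractibleIn A := by
  obtain ⟨H⟩ := h
  exact ⟨H.toContinuousMap, fun x => H.apply_zero x, fun x y =>
    (H.apply_one x).trans (H.apply_one y).symm⟩

namespace LocalSemiflow

variable {X : Type u} [MetricSpace X] {Φ : LocalSemiflow X} {N E : Set X}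

/-- At parameter `s`, flow for the fraction `s` of the hitting time. This time is continuous and
finite on `A`, and it is zero on `E`. -/
theorem IsWazewskiPair.deformsInto (hW : Φ.IsWazewskiPair N E) (hT : Φ.IsTransversal N E)
    (hEN : E ⊆ N) {A : Set N} (hEA : Subtype.val ⁻¹' E ⊆ A)
    (hA : ∀ x ∈ A, Φ.hitTime E (x : X) ≠ ⊤) :
    DeformsInto (Subtype.val ⁻¹' E : Set N) A (Subtype.val ⁻¹' E) := by
  let τ : A → ℝ≥0 := fun x => (Φ.hitTime E (x : X)).toNNReal
  have hτc : Continuous τ :=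
    ENNReal.continuousOn_toNNReal.comp_continuous
      ((hT.continuous_hitTime hW).comp continuous_subtype_val) fun x => hA x x.2
  have hτ : ∀ x : A, (τ x : ℝ≥0∞) = Φ.hitTime E (x : X) := fun x =>
    ENNReal.coe_toNNReal (hA x x.2)
  have hmem : ∀ p : unitInterval × A, ((unitInterval.toNNReal p.1 * τ p.2 : ℝ≥0) : ℝ≥0∞) <
      Φ.T (p.2 : X) ∧ Φ.flow (unitInterval.toNNReal p.1 * τ p.2) (p.2 : X) ∈ N := fun p => by
    refine hW.mem_of_le_hitTime hEN p.2.1.2 ?_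
    rw [← hτ, ENNReal.coe_le_coe]
    exact mul_le_of_le_one_left' (show unitInterval.toNNReal p.1 ≤ 1 from p.1.2.2)
  refine ⟨Set.subset_inter hEA subset_rfl, ⟨fun p => ⟨_, (hmem p).2⟩, ?_⟩, fun x => ⟨?_, ?_⟩,
    fun s x hx => ?_⟩
  · exact (Φ.flow_comp_continuous (by fun_prop) (by fun_prop) fun p => (hmem p).1).subtype_mk _
  · exact Subtype.ext (by simp [Φ.flow_zero])
  · simpa using (hitTime_attained hW.2.1 (hA x x.2)).2
  · have : τ x = 0 := by simp [τ, hitTime_eq_zero (Φ := Φ) (show (x : X) ∈ E from hx)]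
    simpa [this, Φ.flow_zero] using hx

/-- A closed set of points attracted by one equilibrium has a closed neighborhood that is disjoint
from `E` and contractible in `N`. -/
theorem IsLyapunov.exists_contractible_nhds {V : X → ℝ} (hV : Φ.IsLyapunov V)
    (hW : Φ.IsWazewskiPair N E) (hT : Φ.IsTransversal N E) (hN : IsANE N)
    (hfin : {x : X | x ∈ N \ E ∧ Φ.IsEquilibrium x}.Finite) {e : X} (heN : e ∈ N)
    (he : Φ.IsEquilibrium e) {F : Set N} (hF : IsClosed F)
    (hFe : ∀ x ∈ F, Φ.hitTime E (x : X) = ⊤ ∧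
      Tendsto (fun t : ℝ≥0 => Φ.flow t (x : X)) atTop (𝓝 e)) :
    ∃ G : Set N, IsOpen G ∧ F ⊆ G ∧ (∀ x ∈ closure G, (x : X) ∉ E) ∧
      ContractibleIn (closure G) := by
  obtain ⟨U, hU, heU, k, hk0, hk1⟩ := hN.exists_contraction ⟨e, heN⟩
  obtain ⟨U', hU', rfl⟩ := isOpen_induced_iff.1 hU
  -- A continuous choice of a time after which points of `F` stay in `U'`. Admissible times can be
  -- increased, so they form convex sets, and local constant choices glue by a partition of unity.
  obtain ⟨g, hg⟩ : ∃ g : C(N, ℝ), ∀ y : N, g y ∈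
      Set.Ici 0 ∩ {r : ℝ | y ∈ F → ∀ s ≥ r.toNNReal, Φ.flow s (y : X) ∈ U'} := by
    refine exists_continuous_forall_mem_convex_of_local_const (fun y => ?_) fun x => ?_
    · refine (convex_Ici 0).inter (Set.OrdConnected.convex ⟨fun a ha b _ c hc hy s hs => ?_⟩)
      exact ha hy s ((Real.toNNReal_mono hc.1).trans hs)
    · by_cases hx : x ∈ F
      · obtain ⟨r, hr⟩ := hV.exists_time hW hT hfin x.2 (hFe x hx).1 he (hFe x hx).2
          (hU'.mem_nhds heU)
        refine ⟨r, (continuous_subtype_val.continuousAt.eventually hr).mono fun y hy =>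
          ⟨r.2, fun hyF s hs => hy y.2 (hFe y hyF).1 ?_ s (by simpa using hs)⟩⟩
        exact hV.le_of_tendsto (hW.T_eq_top y.2 (hFe y hyF).1) (hFe y hyF).2
      · exact ⟨0, Eventually.mono (hF.isOpen_compl.mem_nhds hx) fun y hy =>
          ⟨Set.mem_Ici.2 le_rfl, fun h => (hy h).elim⟩⟩
  let t : N → ℝ≥0 := fun y => (g y).toNNReal
  have ht : Continuous t := by fun_prop
  let O : Set N := {y | (t y : ℝ≥0∞) < Φ.hitTime E (y : X)} ∩
    {y | (t y : ℝ≥0∞) < Φ.T (y : X) ∧ Φ.flow (t y) (y : X) ∈ U'}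
  have hO : IsOpen O :=
    (isOpen_lt (by fun_prop) (hT.continuous_hitTime hW)).inter
      ((Φ.isOpen_flow_mem hU').preimage (ht.prodMk continuous_subtype_val))
  have hFO : F ⊆ O := fun y hy =>
    ⟨by simp [(hFe y hy).1], by simp [hW.T_eq_top y.2 (hFe y hy).1], (hg y).2 hy _ le_rfl⟩
  obtain ⟨G, hG, hFG, hGO⟩ := normal_exists_closure_subset hF hO hFO
  refine ⟨G, hG, hFG, fun x hx hE => ?_, ?_⟩
  · have := (hGO hx).1
    simp [hitTime_eq_zero hE] at this
  have hmem : ∀ p : unitInterval × closure G,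
      ((unitInterval.toNNReal p.1 * t p.2 : ℝ≥0) : ℝ≥0∞) < Φ.T (p.2 : X) ∧
        Φ.flow (unitInterval.toNNReal p.1 * t p.2) (p.2 : X) ∈ N \ E := fun p => by
    refine hW.mem_of_lt_hitTime p.2.1.2 (lt_of_le_of_lt ?_ (hGO p.2.2).1)
    exact ENNReal.coe_le_coe.2 (mul_le_of_le_one_left' (show unitInterval.toNNReal p.1 ≤ 1 from p.1.2.2))
  let H : C(unitInterval × closure G, N) := ⟨fun p => ⟨_, (hmem p).2.1⟩,
    (Φ.flow_comp_continuous (by fun_prop) (by fun_prop) fun p => (hmem p).1).subtype_mk _⟩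
  have hHU : ∀ x : closure G, (H (1, x) : X) ∈ U' := fun x => by
    simpa [H] using (hGO x.2).2.2
  -- First flow for the time `t` into `U'`, then apply the contraction `k`.
  refine contractibleIn_of_homotopic (e := ⟨e, heN⟩) (ContinuousMap.Homotopic.trans
    (g := ⟨fun x => H (1, x), by fun_prop⟩) ⟨⟨H, fun x => ?_, fun x => rfl⟩⟩
    ⟨⟨⟨fun p => k (p.1, ⟨H (1, p.2), hHU p.2⟩), by fun_prop⟩, fun x => hk0 _, fun x => hk1 _⟩⟩)
  exact Subtype.ext (by simp [H, Φ.flow_zero])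

end LocalSemiflow

/-! ### Passage to the quotient `N/E`. -/

theorem ContractibleIn.of_isClosedEmbedding {Z W : Type u} [TopologicalSpace Z] [TopologicalSpace W]
    {A : Set Z} (hA : ContractibleIn A) {q : Z → W} (hq : Continuous q)
    (hemb : IsClosedEmbedding fun x : A => q x) : ContractibleIn (q '' A) := by
  obtain ⟨h, h0, h1⟩ := hA
  have hrange : q '' A = Set.range fun x : A => q x := by
    ext w
    simp
  rw [hrange]
  let φ := hemb.isEmbedding.toHomeomorph
  refine ⟨⟨fun p => q (h (p.1, φ.symm p.2)), by fun_prop⟩, fun x => ?_, fun x y => ?_⟩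
  · obtain ⟨x, rfl⟩ := φ.surjective x
    simp only [ContinuousMap.coe_mk, Homeomorph.symm_apply_apply, h0]
    rfl
  · exact congrArg q (h1 _ _)

/-- The projection of `Z ⊔ {*}` to `Z/E`. -/
def collapseMap {Z : Type u} (E : Set Z) : Z ⊕ Unit → CollapseSpace E :=
  Quotient.mk (collapseSetoid E)

theorem collapse_eq_iff {Z : Type u} {E : Set Z} {a b : Z ⊕ Unit} :
    collapseMap E a = collapseMap E b ↔
      a = b ∨ (a ∈ Sum.inl '' E ∪ {Sum.inr ()} ∧ b ∈ Sum.inl '' E ∪ {Sum.inr ()}) :=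
  Quotient.eq

theorem collapse_inl_eq_collapsePoint {Z : Type u} {E : Set Z} {x : Z} :
    collapseMap E (Sum.inl x) = collapsePoint E ↔ x ∈ E := by
  refine (collapse_eq_iff (b := Sum.inr ())).trans ?_
  simp

section Collapse

variable {Z : Type u} [TopologicalSpace Z] {E : Set Z}

theorem isQuotientMap_collapse (E : Set Z) :
    IsQuotientMap (collapseMap E) :=
  isQuotientMap_quotient_mk'

theorem isClosed_singleton_inr : IsClosed ({Sum.inr ()} : Set (Z ⊕ Unit)) := by
  simpa using (IsClosedEmbedding.inr (X := Z) (Y := Unit)).isClosedMap {()} (isClosed_discrete _)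

/-- The saturation of a closed set is the set itself or its union with the closed class `E ∪ {*}`.
-/
theorem isClosedMap_collapse (hE : IsClosed E) :
    IsClosedMap (collapseMap E) := fun C hC => by
  have hS : IsClosed (Sum.inl '' E ∪ {Sum.inr ()} : Set (Z ⊕ Unit)) :=
    (IsClosedEmbedding.inl.isClosedMap _ hE).union isClosed_singleton_inr
  rw [← (isQuotientMap_collapse E).isClosed_preimage]
  by_cases h : ∃ c ∈ C, c ∈ (Sum.inl '' E ∪ {Sum.inr ()} : Set (Z ⊕ Unit))
  · obtain ⟨c, hc, hcS⟩ := h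
    convert hC.union hS using 1
    ext a
    simp only [Set.mem_preimage, Set.mem_image, collapse_eq_iff]
    constructor
    · rintro ⟨b, hb, rfl | h⟩
      · exact Or.inl hb
      · exact Or.inr h.2
    · rintro (h | h)
      · exact ⟨a, h, Or.inl rfl⟩
      · exact ⟨c, hc, Or.inr ⟨hcS, h⟩⟩
  · convert hC using 1
    ext a
    simp only [Set.mem_preimage, Set.mem_image, collapse_eq_iff]
    constructor
    · rintro ⟨b, hb, rfl | h'⟩
      · exact hb
      · exact (h ⟨b, hb, h'.1⟩).elim
    · exact fun h => ⟨a, h, Or.inl rfl⟩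

theorem isClosedEmbedding_collapse (hE : IsClosed E) {A : Set Z} (hA : IsClosed A)
    (hAE : ∀ x ∈ A, x ∉ E) :
    IsClosedEmbedding
      fun x : A => collapseMap E (Sum.inl (x : Z)) := by
  refine .of_continuous_injective_isClosedMap
    ((isQuotientMap_collapse E).continuous.comp (continuous_inl.comp continuous_subtype_val))
    (fun x y hxy => ?_)
    ((isClosedMap_collapse hE).comp
      (IsClosedEmbedding.inl.isClosedMap.comp hA.isClosedMap_subtype_val))
  rcases collapse_eq_iff.1 hxy with h | h
  · exact Subtype.ext (Sum.inl_injective h)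
  · simpa [hAE x x.2] using h.1

/-- A deformation of `A` into `E` that preserves `E` descends to the quotient `Z/E`. -/
theorem DeformsInto.collapse (hE : IsClosed E) {A : Set Z} (hA : IsClosed A)
    (h : DeformsInto E A E) :
    DeformsInto {collapsePoint E}
      ((collapseMap E) ''
        (Sum.inl '' A ∪ {Sum.inr ()})) {collapsePoint E} := by
  classical
  obtain ⟨-, h, hh, hhE⟩ := h
  set q : Z ⊕ Unit → CollapseSpace E := collapseMap E with hq
  have hqc : Continuous q := (isQuotientMap_collapse E).continuous
  set B : Set (CollapseSpace E) := q '' (Sum.inl '' A ∪ {Sum.inr ()}) with hB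
  let f : A ⊕ Unit → B := Sum.elim (fun x => ⟨q (Sum.inl x), _, Or.inl ⟨x, x.2, rfl⟩, rfl⟩)
    fun _ => ⟨q (Sum.inr ()), _, Or.inr rfl, rfl⟩
  have hfval : ∀ a, (f a : CollapseSpace E) = q (Sum.map Subtype.val id a) := by
    rintro (a | a) <;> rfl
  have hfc : Continuous f := by
    refine continuous_induced_rng.2 ?_
    refine (hqc.comp (continuous_subtype_val.sumMap continuous_id)).congr fun a => (hfval a).symm
  have hfs : Function.Surjective f := by
    rintro ⟨-, -, ⟨x, hx, rfl⟩ | rfl, rfl⟩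
    · exact ⟨Sum.inl ⟨x, hx⟩, rfl⟩
    · exact ⟨Sum.inr (), rfl⟩
  have hfcl : IsClosedMap f := fun C hC => by
    have : f '' C = Subtype.val ⁻¹' (q '' (Sum.map Subtype.val id '' C)) := by
      ext b
      constructor
      · rintro ⟨a, ha, rfl⟩
        exact ⟨_, ⟨a, ha, rfl⟩, (hfval a).symm⟩
      · rintro ⟨-, ⟨a, ha, rfl⟩, hab⟩
        exact ⟨a, ha, Subtype.ext ((hfval a).trans hab)⟩
    rw [this]
    refine (isClosedMap_collapse hE _ ?_).preimage continuous_subtype_val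
    exact hA.isClosedMap_subtype_val.sumMap IsClosedMap.id _ hC
  have hfq : IsQuotientMap f := hfcl.isQuotientMap hfc hfs
  -- The homotopy in curried form, so that continuity can be checked on each summand; it is constant
  -- at the added base point.
  let K : C(A ⊕ Unit, C(unitInterval, CollapseSpace E)) :=
    ⟨Sum.elim (ContinuousMap.curry ⟨fun p : A × unitInterval => q (Sum.inl (h (p.2, p.1))),
      hqc.comp (by fun_prop)⟩) fun _ => ContinuousMap.const _ (collapsePoint E), by fun_prop⟩
  have hKinl : ∀ s x, K (Sum.inl x) s = q (Sum.inl (h (s, x))) := fun _ _ => rfl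
  have hK : ∀ s a, Sum.map Subtype.val id a ∈ (Sum.inl '' E ∪ {Sum.inr ()} : Set (Z ⊕ Unit)) →
      K a s = collapsePoint E := by
    rintro s (x | x) hx
    · rw [hKinl, hq, collapse_inl_eq_collapsePoint]
      exact hhE s x (by simpa using hx)
    · rfl
  have hKf : ∀ s a b, f a = f b → K a s = K b s := fun s a b hab => by
    have := congrArg Subtype.val hab
    rw [hfval, hfval] at this
    rcases collapse_eq_iff.1 this with h | h
    · rw [Sum.map_injective.2 ⟨Subtype.val_injective, Function.injective_id⟩ h]
    · rw [hK s a h.1, hK s b h.2]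
  let g : unitInterval × B → CollapseSpace E := fun p => K (Function.surjInv hfs p.2) p.1
  have hgf : ∀ s a, g (s, f a) = K a s := fun s a => hKf s _ _ (Function.surjInv_eq hfs _)
  -- Continuity descends along the quotient map `f` because the other factor, the unit interval, is
  -- locally compact.
  have hg : Continuous g := hfq.continuous_lift_prod_right (by
    simp only [hgf]
    fun_prop)
  refine ⟨?_, ⟨g, hg⟩, fun x => ?_, fun s x hx => ?_⟩
  · rw [Set.singleton_subset_iff]
    exact ⟨⟨_, Or.inr rfl, rfl⟩, rfl⟩
  · obtain ⟨a, rfl⟩ := hfs x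
    simp only [ContinuousMap.coe_mk, hgf]
    rcases a with a | a
    · exact ⟨by rw [hKinl, (hh a).1]; rfl,
        by rw [hKinl, Set.mem_singleton_iff, hq, collapse_inl_eq_collapsePoint]; exact (hh a).2⟩
    · exact ⟨rfl, rfl⟩
  · obtain ⟨a, rfl⟩ := hfs x
    simp only [ContinuousMap.coe_mk, hgf, Set.mem_singleton_iff]
    refine hK s a ?_
    have hx' : q (Sum.map Subtype.val id a) = q (Sum.inr ()) := (hfval a).symm.trans hx
    rcases collapse_eq_iff.1 hx' with h | h
    · exact Or.inr h
    · exact h.1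

end Collapse

theorem relCat_le_card {ι : Type*} [Fintype ι] {Z : Type u} [TopologicalSpace Z] {Y A A₀ : Set Z}
    {C : ι → Set Z} (hA₀ : IsClosed A₀) (hC : ∀ i, IsClosed (C i)) (hA : A = A₀ ∪ ⋃ i, C i)
    (hCc : ∀ i, ContractibleIn (C i)) (hY : DeformsInto Y A₀ Y) :
    relCat Y A ≤ Fintype.card ι := by
  let φ := Fintype.equivFin ι
  refine iInf₂_le (Fintype.card ι) ⟨A₀, C ∘ φ.symm, hA₀, fun j => hC _, ?_, fun j => hCc _, hY⟩
  rw [hA, ← φ.symm.surjective.iUnion_comp C]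
  rfl

/-- A cover as in the definition of the relative category of `(Z, E)` whose contractible members are
disjoint from `E` induces one of `(Z/E, [E])`. -/
theorem relCat_collapse_le_card {ι : Type*} [Fintype ι] {Z : Type u} [TopologicalSpace Z]
    {E A₀ : Set Z} {C : ι → Set Z} (hE : IsClosed E) (hA₀ : IsClosed A₀)
    (hC : ∀ i, IsClosed (C i)) (hA : A₀ ∪ ⋃ i, C i = Set.univ)
    (hCc : ∀ i, ContractibleIn (C i)) (hCE : ∀ i, ∀ x ∈ C i, x ∉ E) (hY : DeformsInto E A₀ E) :
    relCat {collapsePoint E} (Set.univ : Set (CollapseSpace E)) ≤ Fintype.card ι := by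
  let q : Z → CollapseSpace E := fun x => collapseMap E (Sum.inl x)
  have hq : Continuous q := (isQuotientMap_collapse E).continuous.comp continuous_inl
  refine relCat_le_card (C := fun i => q '' C i) (isClosedMap_collapse hE _ ?_)
    (fun i => (isClosedMap_collapse hE).comp IsClosedEmbedding.inl.isClosedMap _ (hC i))
    (Set.eq_univ_of_forall fun w => ?_).symm
    (fun i => (hCc i).of_isClosedEmbedding hq (isClosedEmbedding_collapse hE (hC i) (hCE i)))
    (hY.collapse hE hA₀)
  · exact (IsClosedEmbedding.inl.isClosedMap _ hA₀).union isClosed_singleton_inr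
  · obtain ⟨x | x, rfl⟩ := (isQuotientMap_collapse E).surjective w
    · rcases hA.symm.subset (Set.mem_univ x) with h | h
      · exact Or.inl ⟨_, Or.inl ⟨x, h, rfl⟩, rfl⟩
      · obtain ⟨i, hi⟩ := Set.mem_iUnion.1 h
        exact Or.inr (Set.mem_iUnion.2 ⟨i, x, hi, rfl⟩)
    · exact Or.inl ⟨_, Or.inr rfl, rfl⟩

/-! ### Covering the points that never reach `E`. -/

namespace LocalSemiflow

variable {X : Type u} [MetricSpace X] {Φ : LocalSemiflow X} {N E : Set X}

/-- The points of `N` attracted by `a`, away from an open set that contains all points attracted by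
the equilibria not below `a`, form a closed set. -/
theorem IsLyapunov.isClosed_attracted {V : X → ℝ} (hV : Φ.IsLyapunov V)
    (hW : Φ.IsWazewskiPair N E) (hT : Φ.IsTransversal N E)
    (hfin : {x : X | x ∈ N \ E ∧ Φ.IsEquilibrium x}.Finite) {a : X} {O : Set N} (hO : IsOpen O)
    (hOa : ∀ (x : N) (e : X), Φ.hitTime E (x : X) = ⊤ → e ∈ N \ E → Φ.IsEquilibrium e → e ≠ a →
      Tendsto (fun t : ℝ≥0 => Φ.flow t (x : X)) atTop (𝓝 e) → V e ≤ V a ∨ x ∈ O) :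
    IsClosed {x : N | (Φ.hitTime E (x : X) = ⊤ ∧
      Tendsto (fun t : ℝ≥0 => Φ.flow t (x : X)) atTop (𝓝 a)) ∧ x ∉ O} := by
  refine isClosed_of_closure_subset fun x hx => ?_
  have hxO : x ∉ O := closure_minimal (fun y hy => hy.2) hO.isClosed_compl hx
  have hxt : Φ.hitTime E (x : X) = ⊤ :=
    closure_minimal (t := {y : N | Φ.hitTime E (y : X) = ⊤}) (fun y hy => hy.1.1)
      (isClosed_eq (hT.continuous_hitTime hW) continuous_const) hx
  obtain ⟨e, ⟨heN, he⟩, hlim⟩ := hV.exists_tendsto hW hT hfin x.2 hxt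
  rcases eq_or_ne e a with rfl | hea
  · exact ⟨⟨hxt, hlim⟩, hxO⟩
  have hVea : V e ≤ V a := (hOa x e hxt heN he hea hlim).resolve_right hxO
  obtain ⟨r, hr⟩ := hV.exists_time hW hT hfin x.2 hxt he hlim
    (Metric.closedBall_mem_nhds e (half_pos (dist_pos.2 hea.symm)))
  obtain ⟨y, hy, hyr⟩ := ((mem_closure_iff_frequently.1 hx).and_eventually
    (continuous_subtype_val.continuousAt.eventually hr)).exists
  -- The orbit of `y` is eventually within half the distance from `a` to `e` of `e`, yet it
  -- converges to `a`.
  have hya : a ∈ Metric.closedBall e (dist a e / 2) := by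
    refine Metric.isClosed_closedBall.mem_of_tendsto hy.1.2 ?_
    filter_upwards [eventually_ge_atTop r] with t ht
    exact hyr y.2 hy.1.1
      (fun s => hVea.trans (hV.le_of_tendsto (hW.T_eq_top y.2 hy.1.1) hy.1.2 s)) t ht
  have := dist_pos.2 hea.symm
  linarith [Metric.mem_closedBall.1 hya]

/-- Induction from high values of `V` to low ones; the second hypothesis on `P` says that no
equilibrium left out lies above one in `P`. A point attracted by `p` may be covered by the set of
another `q`, since only what earlier sets miss is treated at each step. -/
theorem IsLyapunov.exists_cover {V : X → ℝ} (hV : Φ.IsLyapunov V)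
    (hW : Φ.IsWazewskiPair N E) (hT : Φ.IsTransversal N E) (hN : IsANE N)
    (hfin : {x : X | x ∈ N \ E ∧ Φ.IsEquilibrium x}.Finite) (P : Finset X) :
    (∀ p ∈ P, p ∈ N \ E ∧ Φ.IsEquilibrium p) →
    (∀ p ∈ P, ∀ q, q ∈ N \ E → Φ.IsEquilibrium q → q ∉ P → V q ≤ V p) →
    ∃ G : X → Set N, (∀ p ∈ P, IsOpen (G p) ∧ (∀ x ∈ closure (G p), (x : X) ∉ E) ∧
        ContractibleIn (closure (G p))) ∧
      ∀ x : N, ∀ p ∈ P, Φ.hitTime E (x : X) = ⊤ →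
        Tendsto (fun t : ℝ≥0 => Φ.flow t (x : X)) atTop (𝓝 p) → ∃ q ∈ P, x ∈ G q := by
  classical
  induction P using Finset.induction_on_min_value V with
  | empty => exact fun _ _ => ⟨fun _ => ∅, by simp, by simp⟩
  | insert a s ha hmin ih =>
    intro hP hup
    obtain ⟨G, hG, hGs⟩ := ih (fun p hp => hP p (Finset.mem_insert_of_mem hp))
      fun p hp q hqN hq hqs => by
        rcases eq_or_ne q a with rfl | hqa
        · exact hmin p hp
        · exact hup p (Finset.mem_insert_of_mem hp) q hqN hq (by simp [hqa, hqs])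
    obtain ⟨haN, hae⟩ := hP a (Finset.mem_insert_self a s)
    have hO : IsOpen (⋃ q ∈ s, G q) := isOpen_biUnion fun q hq => (hG q hq).1
    have hF := hV.isClosed_attracted hW hT hfin (a := a) hO fun x e hxt heN he hea hlim => by
      by_cases hes : e ∈ s
      · exact Or.inr (by simpa using hGs x e hes hxt hlim)
      · exact Or.inl (hup a (Finset.mem_insert_self a s) e heN he (by simp [hea, hes]))
    obtain ⟨Ga, hGa, hFG, hGaE, hGac⟩ :=
      hV.exists_contractible_nhds hW hT hN hfin haN.1 hae hF fun x hx => hx.1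
    refine ⟨Function.update G a Ga, fun p hp => ?_, fun x p hp hxt hlim => ?_⟩
    · rcases eq_or_ne p a with rfl | hpa
      · simpa only [Function.update_self] using ⟨hGa, hGaE, hGac⟩
      · simpa only [Function.update_of_ne hpa] using hG p (Finset.mem_of_mem_insert_of_ne hp hpa)
    · have hs : (∃ q ∈ s, x ∈ G q) → ∃ q ∈ insert a s, x ∈ Function.update G a Ga q := by
        rintro ⟨q, hq, hxq⟩
        refine ⟨q, Finset.mem_insert_of_mem hq, ?_⟩
        rwa [Function.update_of_ne (ne_of_mem_of_not_mem hq ha)]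
      by_cases hx : ∃ q ∈ s, x ∈ G q
      · exact hs hx
      · rcases Finset.mem_insert.1 hp with rfl | hp
        · exact ⟨p, Finset.mem_insert_self p s, by
            simpa using hFG ⟨⟨hxt, hlim⟩, by simpa using hx⟩⟩
        · exact hs (hGs x p hp hxt hlim)

end LocalSemiflow

theorem theorem5p4 {X : Type u} [MetricSpace X] [CompleteSpace X]
    (Φ : LocalSemiflow X) (hΦ : Φ.IsGradient) (N E : Set X) (hEN : E ⊆ N)
    (hW : Φ.IsWazewskiPair N E) (hT : Φ.IsTransversal N E) (hN : IsANE N) :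
    relCat (Subtype.val ⁻¹' E : Set N) (Set.univ : Set N) ≤
        {x : X | x ∈ N \ E ∧ Φ.IsEquilibrium x}.encard ∧
      relCat {collapsePoint (Subtype.val ⁻¹' E : Set N)}
          (Set.univ : Set (CollapseSpace (Subtype.val ⁻¹' E : Set N))) ≤
        {x : X | x ∈ N \ E ∧ Φ.IsEquilibrium x}.encard := by
  rcases Set.finite_or_infinite {x : X | x ∈ N \ E ∧ Φ.IsEquilibrium x} with hfin | hinf
  swap
  · rw [hinf.encard_eq]
    exact ⟨le_top, le_top⟩
  obtain ⟨V, hVc, hVa, hVe⟩ := hΦ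
  have hV : Φ.IsLyapunov V := ⟨hVc, hVa, hVe⟩
  set Q := hfin.toFinset with hQ
  have hmemQ : ∀ {p}, p ∈ Q ↔ p ∈ N \ E ∧ Φ.IsEquilibrium p := hfin.mem_toFinset
  have hcard : {x : X | x ∈ N \ E ∧ Φ.IsEquilibrium x}.encard = Fintype.card Q := by
    rw [hfin.encard_eq_coe_toFinset_card, Fintype.card_coe]
  obtain ⟨G, hG, hGQ⟩ := hV.exists_cover hW hT hN hfin Q (fun p hp => hmemQ.1 hp)
    fun p _ q hqN hq hqQ => (hqQ (hmemQ.2 ⟨hqN, hq⟩)).elim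
  -- All points with infinite hitting time lie in some `G q`, so the hitting time is finite on the
  -- complement.
  set A₀ : Set N := (⋃ q ∈ Q, G q)ᶜ with hA₀
  have hA₀c : IsClosed A₀ := (isOpen_biUnion fun q hq => (hG q hq).1).isClosed_compl
  have hcover : A₀ ∪ ⋃ q : Q, closure (G q) = Set.univ := by
    refine Set.eq_univ_of_forall fun x => ?_
    by_cases hx : x ∈ ⋃ q ∈ Q, G q
    · obtain ⟨q, hq, hxq⟩ := Set.mem_iUnion₂.1 hx
      exact Or.inr (Set.mem_iUnion.2 ⟨⟨q, hq⟩, subset_closure hxq⟩)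
    · exact Or.inl hx
  have hdef : DeformsInto (Subtype.val ⁻¹' E : Set N) A₀ (Subtype.val ⁻¹' E) := by
    refine hW.deformsInto hT hEN (fun x hxE hx => ?_) fun x hx htop => hx ?_
    · obtain ⟨q, hq, hxq⟩ := Set.mem_iUnion₂.1 hx
      exact (hG q hq).2.1 x (subset_closure hxq) hxE
    · obtain ⟨e, he, hlim⟩ := hV.exists_tendsto hW hT hfin x.2 htop
      exact Set.mem_iUnion₂.2 (by simpa using hGQ x e (hmemQ.2 he) htop hlim)
  rw [hcard]
  exact ⟨relCat_le_card hA₀c (fun q : Q => isClosed_closure) hcover.symm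
      (fun q => (hG q q.2).2.2) hdef,
    relCat_collapse_le_card (hW.2.1.preimage continuous_subtype_val) hA₀c
      (fun q : Q => isClosed_closure) hcover (fun q => (hG q q.2).2.2)
      (fun q => (hG q q.2).2.1) hdef⟩
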